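/- Let $\beta\in(1,2)$, $I_\beta=[0,\frac1{\beta-1}]$, $L=[0,\frac1\beta)$, $S=[\frac1\beta,\frac1{\beta(\beta-1)}]$, $R=(\frac1{\beta(\beta-1)},\frac1{\beta-1}]$, $T_0(x)=\beta x$, $T_1(x)=\beta x-1$, and let $\Omega=\{0,1\}^{\mathbb N}$ with left shift $\sigma$ and the $(\frac12,\frac12)$ Bernoulli measure $m_{1/2}$. The random $\beta$-transformation $K_\beta:\Omega\times I_\beta\to\Omega\times I_\beta$ is given by $K_\beta(\omega,x)=(\omega,T_0(x))$ if $x\in L$, $(\sigma(\omega),T_{\omega_1}(x))$ if $x\in S$, and $(\omega,T_1(x))$ if $x\in R$. Let $R_\beta$ be the skew product with $R_\beta(\omega,x)=(\sigma(\omega),T_0(x))$, $(\sigma(\omega),T_{\omega_1}(x))$, $(\sigma(\omega),T_1(x))$ in these three cases respectively, and let $R^n_{\beta,\omega_1\cdots\omega_n}(x)$ be the second coordinate of $R_\beta^n(\omega,x)$, which depends only on $x$ and the first $n$ letters of $\omega$. Then there is exactly one probability measure $\mu_\beta$ on $I_\beta$ that is absolutely continuous with respect to Lebesgue measure and for which $m_{1/2}\times\mu_\beta$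 is $K_\beta$-invariant. Its density with respect to Lebesgue measure is $$\rho_\beta(x)=C\sum_{n=0}^{\infty}\frac1{(2\beta)^n}\sum_{\omega_1\cdots\omega_n\in\{0,1\}^n}\left(\chi_{[0,R^n_{\beta,\omega_1\cdots\omega_n}(1)]}(x)+\chi_{[R^n_{\beta,\omega_1\cdots\omega_n}(\frac1{\beta-1}-1),\frac1{\beta-1}]}(x)\right),$$ where the series converges for every $x$ and $C>0$ is the constant, depending only on $\beta$, for which $\int_{I_\beta}\rho_\beta(x)\,dx=1$. -/

import Mathlib

open MeasureTheory Set

namespace RandomBeta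

/-- The sequence space `Ω = {0,1}^ℕ`; the first letter `ω₁` of `ω` is `ω 0`. -/
abbrev Omega : Type := ℕ → Fin 2

/-- The left shift on `Ω`. -/
def shift (ω : Omega) : Omega := fun n => ω (n + 1)

/-- The `(1/2, 1/2)` Bernoulli measure on `Ω`. -/
noncomputable def bernoulli : Measure Omega :=
  Measure.infinitePi fun _ : ℕ => (PMF.uniformOfFintype (Fin 2)).toMeasure

/-- The interval `[0, 1/(β-1)]`. -/
def I (β : ℝ) : Set ℝ := Icc 0 (1 / (β - 1))

/-- The left part of the interval. -/
def L (β : ℝ) : Set ℝ := Ico 0 (1 / β)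

/-- The switch region. -/
def S (β : ℝ) : Set ℝ := Icc (1 / β) (1 / (β * (β - 1)))

/-- The affine maps `T₀ x = β x` and `T₁ x = β x - 1`. -/
def T (β : ℝ) (i : Fin 2) (x : ℝ) : ℝ := β * x - ((i : ℕ) : ℝ)

open Classical in
/-- The random `β`-transformation. On `Ω × I β` the last case is `x ∈ (1/(β(β-1)), 1/(β-1)]`;
the values outside `Ω × I β` are irrelevant. -/
noncomputable def K (β : ℝ) (p : Omega × ℝ) : Omega × ℝ :=
  if p.2 ∈ L β then (p.1, T β 0 p.2)
  else if p.2 ∈ S β then (shift p.1, T β (p.1 0) p.2)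
  else (p.1, T β 1 p.2)

open Classical in
/-- The skew product `R_β`. On `Ω × I β` the last case is `x ∈ (1/(β(β-1)), 1/(β-1)]`;
the values outside `Ω × I β` are irrelevant. -/
noncomputable def skewR (β : ℝ) (p : Omega × ℝ) : Omega × ℝ :=
  if p.2 ∈ L β then (shift p.1, T β 0 p.2)
  else if p.2 ∈ S β then (shift p.1, T β (p.1 0) p.2)
  else (shift p.1, T β 1 p.2)

open Classical in
/-- The action of `R_β` on the second coordinate when the first letter of `ω` is `i`. -/
noncomputable def fiberMap (β : ℝ) (i : Fin 2) (x : ℝ) : ℝ :=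
  if x ∈ L β then T β 0 x else if x ∈ S β then T β i x else T β 1 x

/-- `orbit β n (ω₁ ⋯ ωₙ) x` is the second coordinate of `R_β^n (ω, x)` for any `ω` that begins
with `ω₁ ⋯ ωₙ` (see `skewR_iterate_snd`). -/
noncomputable def orbit (β : ℝ) : (n : ℕ) → (Fin n → Fin 2) → ℝ → ℝ
  | 0, _, x => x
  | n + 1, w, x => fiberMap β (w (Fin.last n)) (orbit β n (fun k => w k.castSucc) x)

/-- The `n`-th term of the series for the (unnormalised) density. -/
noncomputable def densityTerm (β : ℝ) (x : ℝ) (n : ℕ) : ℝ :=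
  1 / (2 * β) ^ n * ∑ w : Fin n → Fin 2,
    ((Icc 0 (orbit β n w 1)).indicator (fun _ => (1 : ℝ)) x +
      (Icc (orbit β n w (1 / (β - 1) - 1)) (1 / (β - 1))).indicator (fun _ => (1 : ℝ)) x)

/-- `μ` is a probability measure on `[0, 1/(β-1)]`, absolutely continuous with respect to
Lebesgue measure, such that the product of the Bernoulli measure with `μ` is invariant under the
random `β`-transformation. -/
structure IsUnbiasedACIM (β : ℝ) (μ : Measure ℝ) : Prop where
  isProbabilityMeasure : IsProbabilityMeasure μ
  support : μ (I β)ᶜ = 0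
  absolutelyContinuous : μ ≪ volume
  invariant : MeasurePreserving (K β) (bernoulli.prod μ) (bernoulli.prod μ)

theorem skewR_eq (β : ℝ) (p : Omega × ℝ) :
    skewR β p = (shift p.1, fiberMap β (p.1 0) p.2) := by
  unfold skewR fiberMap
  split_ifs <;> rfl

theorem skewR_iterate (β : ℝ) (n : ℕ) (ω : Omega) (x : ℝ) :
    (skewR β)^[n] (ω, x) = (fun k => ω (k + n), orbit β n (fun k => ω k) x) := by
  induction n with
  | zero => rfl
  | succ n ih =>
    rw [Function.iterate_succ_apply', ih, skewR_eq]
    refine Prod.ext ?_ ?_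
    · funext k
      simp only [shift]
      congr 1
      omega
    · simp [orbit]

theorem skewR_iterate_snd (β : ℝ) (n : ℕ) (ω : Omega) (x : ℝ) :
    ((skewR β)^[n] (ω, x)).2 = orbit β n (fun k => ω k) x := by
  rw [skewR_iterate]

/-- The fibre maps, hence also `K β` and `skewR β`, preserve the interval `I β`. -/
theorem fiberMap_mem {β : ℝ} (h1 : 1 < β) (h2 : β < 2) (i : Fin 2) {x : ℝ} (hx : x ∈ I β) :
    fiberMap β i x ∈ I β := by
  have hb : 0 < β - 1 := by linarith
  have hb0 : 0 < β := by linarith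
  have hM : 1 < 1 / (β - 1) := by rw [lt_div_iff₀ hb]; linarith
  have hM' : β * (1 / (β - 1)) = 1 / (β - 1) + 1 := by field_simp; ring
  have hq : β * (1 / β) = 1 := by field_simp
  have hq' : β * (1 / (β * (β - 1))) = 1 / (β - 1) := by field_simp
  obtain ⟨hx0, hxM⟩ := hx
  have hxm := mul_le_mul_of_nonneg_left hxM hb0.le
  unfold fiberMap T
  split_ifs with hL hS
  · have := mul_le_mul_of_nonneg_left hL.2.le hb0.le
    constructor <;> simp <;> first | positivity | (simp at hM this hq; nlinarith)
  · have h3 := mul_le_mul_of_nonneg_left hS.1 hb0.le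
    have h4 := mul_le_mul_of_nonneg_left hS.2 hb0.le
    rw [hq] at h3
    rw [hq'] at h4
    have hi : ((i : ℕ) : ℝ) ≤ 1 := by exact_mod_cast Nat.lt_succ_iff.mp i.2
    have hi0 : (0 : ℝ) ≤ ((i : ℕ) : ℝ) := Nat.cast_nonneg _
    constructor <;> linarith
  · have hx1 : 1 / β ≤ x := by
      by_contra hlt
      exact hL ⟨hx0, not_le.mp hlt⟩
    have h3 := mul_le_mul_of_nonneg_left hx1 hb0.le
    rw [hq] at h3
    rw [hM'] at hxm
    constructor
    · simp; linarith
    · simp only [Fin.val_one, Nat.cast_one]; linarith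

theorem K_snd (β : ℝ) (p : Omega × ℝ) : (K β p).2 = fiberMap β (p.1 0) p.2 := by
  unfold K fiberMap
  split_ifs <;> rfl

end RandomBeta

open MeasureTheory Set

namespace RandomBeta

/-! The first letter is fair and independent of the shifted sequence, so invariance of the product
measure under `K` amounts to stationarity of `μ` under the average of the two fibre maps
(`measurePreserving_K_iff`). Everything else happens on the line.

Existence: a branch sends Lebesgue measure on an interval to `β⁻¹` times Lebesgue measure on its
image. After symmetrisation under `x ↦ 1/(β-1) - x`, transferring the piece for `[0, y]` by both
letters gives `β⁻¹` times the pieces for `[0, fiberMap β i y]`, plus a multiple of the piece for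
`[0, 1]` (`sum_symmMass_preimage`). Summed over the orbits of `1` this telescopes, so the series is
stationary up to a multiple of its first term (`sum_tsum_orbitTerm_preimage`). Conservation of total
mass forces that multiple to be zero (`sum_integral_density_preimage`).

Uniqueness: let `h` be the difference of two stationary densities. The sets where `h` is positive
and where it is negative are forward invariant modulo null sets. If such a set is not null,
expanding small intervals around a density point shows that it fills almost all of the switch region
(`volume_switch_diff_eq_zero`). Two disjoint sets cannot both do so, hence `h` has one sign; its
integral is zero, so it vanishes almost everywhere. -/

/-! ### Affine branches of the fibre maps and the reflection symmetry. -/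

theorem measurable_fiberMap (β : ℝ) (i : Fin 2) : Measurable (fiberMap β i) := by
  have hT : ∀ j : Fin 2, Measurable (T β j) := fun j => by unfold T; fun_prop
  unfold fiberMap
  exact Measurable.ite measurableSet_Ico (hT 0)
    (Measurable.ite measurableSet_Icc (hT i) (hT 1))

theorem fiberMap_zero_of_le {β x : ℝ} (hx0 : 0 ≤ x) (hx : x ≤ 1 / (β * (β - 1))) :
    fiberMap β 0 x = β * x := by
  unfold fiberMap T
  split_ifs with hL hS
  · simp
  · simp
  · exact absurd ⟨not_lt.mp fun h => hL ⟨hx0, h⟩, hx⟩ hS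

theorem fiberMap_of_lt {β x : ℝ} (hx0 : 0 ≤ x) (hx : x < 1 / β) (i : Fin 2) :
    fiberMap β i x = β * x := by
  unfold fiberMap T
  rw [if_pos ⟨hx0, hx⟩]
  simp

theorem fiberMap_one_of_le {β x : ℝ} (hx : 1 / β ≤ x) : fiberMap β 1 x = β * x - 1 := by
  unfold fiberMap T
  rw [if_neg fun h => absurd h.2 (not_lt.mpr hx)]
  simp

theorem fiberMap_of_gt {β x : ℝ} (hx : 1 / β ≤ x) (hx' : 1 / (β * (β - 1)) < x) (i : Fin 2) :
    fiberMap β i x = β * x - 1 := by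
  unfold fiberMap T
  rw [if_neg fun h => absurd h.2 (not_lt.mpr hx), if_neg fun h => absurd h.2 (not_le.mpr hx')]
  simp

theorem switch_bounds {β : ℝ} (h1 : 1 < β) (h2 : β < 2) :
    0 < 1 / β ∧ 1 / β < 1 / (β * (β - 1)) ∧ 1 / (β * (β - 1)) < 1 / (β - 1) ∧
      1 / (β - 1) - 1 / β = 1 / (β * (β - 1)) ∧ 1 < 1 / (β - 1) := by
  have hb : 0 < β - 1 := by linarith
  have hb0 : 0 < β := by linarith
  refine ⟨by positivity, ?_, ?_, ?_, ?_⟩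
  · apply one_div_lt_one_div_of_lt <;> nlinarith
  · apply one_div_lt_one_div_of_lt <;> nlinarith
  · field_simp; ring
  · rw [lt_div_iff₀ hb]; linarith

/-- The reflection `x ↦ 1/(β-1) - x` exchanges the two fibre maps. -/
theorem fiberMap_reflect {β : ℝ} (h1 : 1 < β) (h2 : β < 2) (i : Fin 2) {x : ℝ} (hx : x ∈ I β) :
    fiberMap β i (1 / (β - 1) - x) = 1 / (β - 1) - fiberMap β (Fin.rev i) x := by
  obtain ⟨hs, hst, htM, hM, hM1⟩ := switch_bounds h1 h2
  have hβM : β * (1 / (β - 1)) = 1 / (β - 1) + 1 := by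
    have : β - 1 ≠ 0 := by linarith
    field_simp; ring
  obtain ⟨hx0, hxM⟩ := hx
  rcases lt_or_ge x (1 / β) with hL | hL
  · rw [fiberMap_of_gt (by linarith) (by linarith), fiberMap_of_lt hx0 hL]
    linarith
  rcases le_or_gt x (1 / (β * (β - 1))) with hS | hS
  · fin_cases i
    · change fiberMap β 0 _ = _ - fiberMap β 1 x
      rw [fiberMap_zero_of_le (by linarith) (by linarith), fiberMap_one_of_le hL]
      linarith
    · change fiberMap β 1 _ = _ - fiberMap β 0 x
      rw [fiberMap_one_of_le (by linarith), fiberMap_zero_of_le hx0 hS]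
      linarith
  · rw [fiberMap_of_lt (by linarith) (by linarith), fiberMap_of_gt hL hS]
    linarith

theorem orbit_mem {β : ℝ} (h1 : 1 < β) (h2 : β < 2) {x : ℝ} (hx : x ∈ I β) (n : ℕ)
    (w : Fin n → Fin 2) : orbit β n w x ∈ I β := by
  induction n with
  | zero => exact hx
  | succ n ih => exact fiberMap_mem h1 h2 _ (ih _)

theorem orbit_reflect {β : ℝ} (h1 : 1 < β) (h2 : β < 2) {x : ℝ} (hx : x ∈ I β) (n : ℕ)
    (w : Fin n → Fin 2) :
    orbit β n w (1 / (β - 1) - x) = 1 / (β - 1) - orbit β n (fun k => Fin.rev (w k)) x := by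
  induction n with
  | zero => rfl
  | succ n ih =>
    simp only [orbit]
    rw [ih, fiberMap_reflect h1 h2 _ (orbit_mem h1 h2 hx _ _)]

theorem one_mem_I {β : ℝ} (h1 : 1 < β) (h2 : β < 2) : (1 : ℝ) ∈ I β :=
  ⟨zero_le_one, (switch_bounds h1 h2).2.2.2.2.le⟩

/-! ### One transfer step for the indicator of an interval. -/

section OneStep

variable {β : ℝ} {g : ℝ → ℝ}

theorem integral_fiberMap_zero_of_le (h1 : 1 < β) {y : ℝ} (hy0 : 0 ≤ y)
    (hy : y ≤ 1 / (β * (β - 1))) :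
    ∫ x in (0 : ℝ)..y, g (fiberMap β 0 x) = β⁻¹ * ∫ x in (0 : ℝ)..(β * y), g x := by
  rw [intervalIntegral.integral_congr_Ioo_of_le (g := fun x => g (β * x)) hy0
    fun x hx => by
      show g _ = g _
      rw [fiberMap_zero_of_le hx.1.le (hx.2.le.trans hy)],
    intervalIntegral.integral_comp_mul_left g (by linarith : β ≠ 0)]
  simp

theorem integral_fiberMap_of_le (h1 : 1 < β) {y : ℝ} (hy0 : 0 ≤ y) (hy : y ≤ 1 / β) (i : Fin 2) :
    ∫ x in (0 : ℝ)..y, g (fiberMap β i x) = β⁻¹ * ∫ x in (0 : ℝ)..(β * y), g x := by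
  rw [intervalIntegral.integral_congr_Ioo_of_le (g := fun x => g (β * x)) hy0
    fun x hx => by
      show g _ = g _
      rw [fiberMap_of_lt hx.1.le (hx.2.trans_le hy)],
    intervalIntegral.integral_comp_mul_left g (by linarith : β ≠ 0)]
  simp

theorem integral_fiberMap_one_of_ge (h1 : 1 < β) {y z : ℝ} (hy : 1 / β ≤ y) (hyz : y ≤ z) :
    ∫ x in y..z, g (fiberMap β 1 x) = β⁻¹ * ∫ x in (β * y - 1)..(β * z - 1), g x := by
  rw [intervalIntegral.integral_congr_Ioo_of_le (g := fun x => g (β * x - 1)) hyz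
    fun x hx => by
      show g _ = g _
      rw [fiberMap_one_of_le (hy.trans hx.1.le)],
    intervalIntegral.integral_comp_mul_sub g (by linarith : β ≠ 0)]
  simp

theorem integral_fiberMap_of_ge (h1 : 1 < β) {y z : ℝ} (hy : 1 / β ≤ y)
    (hy' : 1 / (β * (β - 1)) ≤ y) (hyz : y ≤ z) (i : Fin 2) :
    ∫ x in y..z, g (fiberMap β i x) = β⁻¹ * ∫ x in (β * y - 1)..(β * z - 1), g x := by
  rw [intervalIntegral.integral_congr_Ioo_of_le (g := fun x => g (β * x - 1)) hyz
    fun x hx => by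
      show g _ = g _
      rw [fiberMap_of_gt (hy.trans hx.1.le) (hy'.trans_lt hx.1)],
    intervalIntegral.integral_comp_mul_sub g (by linarith : β ≠ 0)]
  simp

/-- How often `y` lies beyond the left end and beyond the right end of the switch region. -/
noncomputable def escape (β y : ℝ) : ℝ :=
  (Ici (1 / β)).indicator (fun _ => 1) y + (Ioi (1 / (β * (β - 1)))).indicator (fun _ => 1) y

theorem escape_nonneg (β y : ℝ) : 0 ≤ escape β y :=
  add_nonneg (indicator_nonneg (fun _ _ => zero_le_one) _)
    (indicator_nonneg (fun _ _ => zero_le_one) _)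

theorem escape_le_two (β y : ℝ) : escape β y ≤ 2 := by
  have := indicator_le_self' (s := Ici (1 / β)) (f := fun _ : ℝ => (1 : ℝ))
    (fun _ _ => zero_le_one) y
  have := indicator_le_self' (s := Ioi (1 / (β * (β - 1)))) (f := fun _ : ℝ => (1 : ℝ))
    (fun _ _ => zero_le_one) y
  unfold escape
  linarith

/-- The averaged transfer operator, applied to the indicator of `[0, y]` and tested against a
function that is invariant under the reflection of the interval. -/
theorem sum_integral_fiberMap (h1 : 1 < β) (h2 : β < 2)
    (hg : ∀ a b, IntervalIntegrable g volume a b)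
    (hgτ : ∀ i a b, IntervalIntegrable (fun x => g (fiberMap β i x)) volume a b)
    (hsymm : ∀ x, g (1 / (β - 1) - x) = g x) {y : ℝ} (hy : y ∈ I β) :
    ∑ i : Fin 2, ∫ x in (0 : ℝ)..y, g (fiberMap β i x) =
      β⁻¹ * (∑ i : Fin 2, (∫ x in (0 : ℝ)..fiberMap β i y, g x) +
        escape β y * ∫ x in (0 : ℝ)..1, g x) := by
  obtain ⟨hs, hst, htM, hM, hM1⟩ := switch_bounds h1 h2
  have hb : β - 1 ≠ 0 := by linarith
  have hb0 : β ≠ 0 := by linarith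
  have hq : β * (1 / β) = 1 := by field_simp
  have hq' : β * (1 / (β * (β - 1))) = 1 / (β - 1) := by field_simp
  obtain ⟨hy0, hyM⟩ := hy
  have hone : ∀ z, 1 / β ≤ z → ∫ x in (0 : ℝ)..z, g (fiberMap β 1 x) =
      β⁻¹ * ((∫ x in (0 : ℝ)..1, g x) + ∫ x in (0 : ℝ)..(β * z - 1), g x) := fun z hz => by
    rw [← intervalIntegral.integral_add_adjacent_intervals (hgτ 1 0 (1 / β)) (hgτ 1 _ _),
      integral_fiberMap_of_le h1 hs.le le_rfl, integral_fiberMap_one_of_ge h1 le_rfl hz, hq]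
    simp [mul_add]
  -- The only use of symmetry: the piece at the right end of the interval becomes another copy of
  -- the piece over `[0, 1]`.
  have hrefl : ∫ x in (1 / (β - 1) - 1)..(1 / (β - 1)), g x = ∫ x in (0 : ℝ)..1, g x := by
    have := intervalIntegral.integral_comp_sub_left (a := 0) (b := 1) g (1 / (β - 1))
    rw [sub_zero] at this
    rw [← this]
    simp only [hsymm]
  unfold escape
  rw [Fin.sum_univ_two, Fin.sum_univ_two]
  -- The identity is needed at every `y`, because orbits may hit the ends of the switch region. The
  -- open and closed ends in `escape` therefore follow those of `fiberMap`.
  rcases lt_or_ge y (1 / β) with hL | hL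
  · rw [integral_fiberMap_of_le h1 hy0 hL.le, integral_fiberMap_of_le h1 hy0 hL.le,
      fiberMap_of_lt hy0 hL, fiberMap_of_lt hy0 hL, indicator_of_notMem (by simpa using hL),
      indicator_of_notMem (by simpa using (hL.trans hst).le)]
    ring
  rw [indicator_of_mem (mem_Ici.mpr hL), hone y hL, fiberMap_one_of_le hL]
  rcases le_or_gt y (1 / (β * (β - 1))) with hS | hS
  · rw [integral_fiberMap_zero_of_le h1 hy0 hS, fiberMap_zero_of_le hy0 hS,
      indicator_of_notMem (by simpa using hS)]
    ring
  -- For letter `0` the branch on `[0, 1/(β(β-1))]` already covers the whole interval. Its part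
  -- beyond `1/(β-1) - 1` is the surplus, and the rest joins the image of the second branch to give
  -- `[0, β y - 1]`.
  · rw [fiberMap_of_gt hL hS, indicator_of_mem (mem_Ioi.mpr hS),
      ← intervalIntegral.integral_add_adjacent_intervals (hgτ 0 0 (1 / (β * (β - 1)))) (hgτ 0 _ _),
      integral_fiberMap_zero_of_le h1 (hs.trans hst).le le_rfl,
      integral_fiberMap_of_ge h1 hst.le le_rfl hS.le, hq',
      ← intervalIntegral.integral_add_adjacent_intervals (hg 0 (1 / (β - 1) - 1))
        (hg _ (1 / (β - 1))),
      hrefl,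
      ← intervalIntegral.integral_add_adjacent_intervals (hg 0 (1 / (β - 1) - 1)) (hg _ (β * y - 1))]
    ring

end OneStep

/-! ### Discounted sums over the orbits of `1`. -/

/-- The discounted sum of `φ` over the orbits of `1` of length `n`. -/
noncomputable def orbitTerm (β : ℝ) (φ : ℝ → ℝ) (n : ℕ) : ℝ :=
  1 / (2 * β) ^ n * ∑ w : Fin n → Fin 2, φ (orbit β n w 1)

theorem orbitTerm_congr {β : ℝ} (h1 : 1 < β) (h2 : β < 2) {φ ψ : ℝ → ℝ}
    (h : ∀ y ∈ I β, φ y = ψ y) (n : ℕ) : orbitTerm β φ n = orbitTerm β ψ n := by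
  unfold orbitTerm
  congr 1
  exact Finset.sum_congr rfl fun w _ => h _ (orbit_mem h1 h2 (one_mem_I h1 h2) n w)

theorem orbitTerm_add (β : ℝ) (φ ψ : ℝ → ℝ) (n : ℕ) :
    orbitTerm β (fun y => φ y + ψ y) n = orbitTerm β φ n + orbitTerm β ψ n := by
  unfold orbitTerm
  rw [Finset.sum_add_distrib, mul_add]

theorem orbitTerm_mul_const (β : ℝ) (φ : ℝ → ℝ) (c : ℝ) (n : ℕ) :
    orbitTerm β (fun y => φ y * c) n = orbitTerm β φ n * c := by
  unfold orbitTerm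
  rw [← Finset.sum_mul, mul_assoc]

/-- The last letter of a word acts last, so splitting it off turns one more step of the orbit into
an average of `φ` over the fibre maps. This is the index shift behind the telescoping. -/
theorem orbitTerm_succ (β : ℝ) (φ : ℝ → ℝ) (n : ℕ) :
    orbitTerm β φ (n + 1) =
      orbitTerm β (fun y => 1 / (2 * β) * ∑ i : Fin 2, φ (fiberMap β i y)) n := by
  unfold orbitTerm
  rw [← Finset.mul_sum, ← mul_assoc, ← (Fin.snocEquiv fun _ : Fin (n + 1) => Fin 2).sum_comp,
    Fintype.sum_prod_type, Finset.sum_comm]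
  congr 1
  · rw [one_div, one_div, one_div, pow_succ, mul_inv]
  · refine Finset.sum_congr rfl fun w _ => Finset.sum_congr rfl fun i _ => ?_
    simp [orbit, Fin.snocEquiv]

/-- The `2 ^ n` words cancel the factor `2 ^ n` in the weight and leave a geometric series of ratio
`1 / β`. -/
theorem summable_orbitTerm {β : ℝ} (h1 : 1 < β) (h2 : β < 2) {φ : ℝ → ℝ} {k : ℝ}
    (h : ∀ y ∈ I β, |φ y| ≤ k) : Summable (orbitTerm β φ) := by
  have hβ : 0 < β := by linarith
  refine Summable.of_norm_bounded (g := fun n => k * (1 / β) ^ n)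
    ((summable_geometric_of_lt_one (by positivity) ?_).mul_left k) fun n => ?_
  · rw [div_lt_one hβ]; exact h1
  · have hs : |∑ w : Fin n → Fin 2, φ (orbit β n w 1)| ≤ 2 ^ n * k := by
      refine (Finset.abs_sum_le_sum_abs _ _).trans ?_
      refine (Finset.sum_le_card_nsmul _ _ k fun w _ =>
        h _ (orbit_mem h1 h2 (one_mem_I h1 h2) n w)).trans ?_
      simp
    unfold orbitTerm
    rw [Real.norm_eq_abs, abs_mul, abs_of_pos (by positivity : (0 : ℝ) < 1 / (2 * β) ^ n)]
    refine (mul_le_mul_of_nonneg_left hs (by positivity)).trans (le_of_eq ?_)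
    rw [mul_pow, div_pow, one_pow]
    field_simp

/-- Flipping every letter turns the orbit of `1/(β-1) - 1` into the reflected orbit of `1`, so only
orbits of `1` remain. -/
theorem densityTerm_eq {β : ℝ} (h1 : 1 < β) (h2 : β < 2) (x : ℝ) (n : ℕ) :
    densityTerm β x n = orbitTerm β (fun y => (Icc 0 y).indicator (fun _ => (1 : ℝ)) x +
      (Icc 0 y).indicator (fun _ => (1 : ℝ)) (1 / (β - 1) - x)) n := by
  unfold densityTerm orbitTerm
  congr 1
  rw [Finset.sum_add_distrib, Finset.sum_add_distrib]
  congr 1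
  let e : (Fin n → Fin 2) ≃ (Fin n → Fin 2) := Equiv.arrowCongr (Equiv.refl _) Fin.revPerm
  rw [← e.sum_comp]
  refine Finset.sum_congr rfl fun w _ => ?_
  rw [show orbit β n w 1 = 1 / (β - 1) - orbit β n (e w) (1 / (β - 1) - 1) by
    rw [orbit_reflect h1 h2 (one_mem_I h1 h2)]
    simp [e]]
  simp only [indicator, mem_Icc]
  congr 1
  rw [eq_iff_iff]
  constructor <;> rintro ⟨h, h'⟩ <;> constructor <;> linarith

theorem densityTerm_nonneg {β : ℝ} (h1 : 1 < β) (x : ℝ) (n : ℕ) : 0 ≤ densityTerm β x n :=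
  mul_nonneg (by positivity) (Finset.sum_nonneg fun _ _ => add_nonneg
    (indicator_nonneg (fun _ _ => zero_le_one) _) (indicator_nonneg (fun _ _ => zero_le_one) _))

theorem summable_densityTerm {β : ℝ} (h1 : 1 < β) (h2 : β < 2) (x : ℝ) :
    Summable (densityTerm β x) := by
  rw [funext (densityTerm_eq h1 h2 x)]
  refine summable_orbitTerm h1 h2 (k := 2) fun y _ => ?_
  have hi : ∀ z : ℝ, 0 ≤ (Icc 0 y).indicator (fun _ => (1 : ℝ)) z ∧
      (Icc 0 y).indicator (fun _ => (1 : ℝ)) z ≤ 1 := fun z =>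
    ⟨indicator_nonneg (fun _ _ => zero_le_one) _,
      indicator_le_self' (f := fun _ : ℝ => (1 : ℝ)) (fun _ _ => zero_le_one) z⟩
  rw [abs_of_nonneg (add_nonneg (hi _).1 (hi _).1)]
  linarith [(hi x).2, (hi (1 / (β - 1) - x)).2]

/-! ### Integrals of the series over measurable sets. -/

/-- The indicator of a set, symmetrised under the reflection of the interval. -/
noncomputable def symmIndicator (β : ℝ) (B : Set ℝ) (x : ℝ) : ℝ :=
  B.indicator (fun _ => 1) x + B.indicator (fun _ => 1) (1 / (β - 1) - x)

theorem symmIndicator_reflect (β : ℝ) (B : Set ℝ) (x : ℝ) :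
    symmIndicator β B (1 / (β - 1) - x) = symmIndicator β B x := by
  unfold symmIndicator
  rw [sub_sub_cancel, add_comm]

theorem symmIndicator_nonneg (β : ℝ) (B : Set ℝ) (x : ℝ) : 0 ≤ symmIndicator β B x :=
  add_nonneg (indicator_nonneg (fun _ _ => zero_le_one) _)
    (indicator_nonneg (fun _ _ => zero_le_one) _)

theorem symmIndicator_le (β : ℝ) (B : Set ℝ) (x : ℝ) : symmIndicator β B x ≤ 2 := by
  have hi : ∀ z : ℝ, B.indicator (fun _ => (1 : ℝ)) z ≤ 1 := fun z =>
    indicator_le_self' (f := fun _ : ℝ => (1 : ℝ)) (fun _ _ => zero_le_one) z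
  unfold symmIndicator
  linarith [hi x, hi (1 / (β - 1) - x)]

theorem measurable_symmIndicator (β : ℝ) {B : Set ℝ} (hB : MeasurableSet B) :
    Measurable (symmIndicator β B) := by
  have hi : Measurable (B.indicator fun _ => (1 : ℝ)) := measurable_const.indicator hB
  exact hi.add (hi.comp (by fun_prop))

theorem intervalIntegrable_of_mem_Icc {f : ℝ → ℝ} (hf : Measurable f) {k : ℝ}
    (h0 : ∀ x, 0 ≤ f x) (hk : ∀ x, f x ≤ k) (a b : ℝ) : IntervalIntegrable f volume a b :=
  (intervalIntegrable_const (c := k)).mono_fun hf.aestronglyMeasurable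
    (Filter.Eventually.of_forall fun x => by
      show ‖f x‖ ≤ ‖k‖
      rw [Real.norm_of_nonneg (h0 x), Real.norm_of_nonneg ((h0 x).trans (hk x))]
      exact hk x)

/-- The mass of `B` under Lebesgue measure on `[0, y]` and on its reflection. -/
noncomputable def symmMass (β : ℝ) (B : Set ℝ) (y : ℝ) : ℝ :=
  ∫ x in (0 : ℝ)..y, symmIndicator β B x

theorem abs_symmMass_le {β : ℝ} (B : Set ℝ) {y : ℝ} (hy : y ∈ I β) :
    |symmMass β B y| ≤ 2 * (1 / (β - 1)) := by
  unfold symmMass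
  rw [← Real.norm_eq_abs]
  refine (intervalIntegral.norm_integral_le_of_norm_le_const (C := 2) fun x _ => ?_).trans ?_
  · rw [Real.norm_of_nonneg (symmIndicator_nonneg β B x)]
    exact symmIndicator_le β B x
  · rw [sub_zero, abs_of_nonneg hy.1]
    linarith [hy.2]

theorem summable_orbitTerm_symmMass {β : ℝ} (h1 : 1 < β) (h2 : β < 2) (B : Set ℝ) :
    Summable (orbitTerm β (symmMass β B)) :=
  summable_orbitTerm h1 h2 fun _ hy => abs_symmMass_le B hy

theorem integral_densityTerm {β : ℝ} (h1 : 1 < β) (h2 : β < 2) {B : Set ℝ} (hB : MeasurableSet B)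
    (n : ℕ) : IntegrableOn (fun x => densityTerm β x n) B ∧
      ∫ x in B, densityTerm β x n = orbitTerm β (symmMass β B) n := by
  have hy : ∀ y, 0 ≤ y → Integrable (fun x => (Icc 0 y).indicator (fun _ => (1 : ℝ)) x) ∧
      Integrable fun x => (Icc 0 y).indicator (fun _ => (1 : ℝ)) (1 / (β - 1) - x) := fun y _ => by
    have := (integrable_indicator_iff (μ := volume) (f := fun _ : ℝ => (1 : ℝ))
      (measurableSet_Icc (a := 0) (b := y))).mpr (by simp)
    exact ⟨this, this.comp_sub_left _⟩
  have hBi : Measurable (B.indicator fun _ => (1 : ℝ)) := measurable_const.indicator hB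
  have h01 : ∀ x, 0 ≤ B.indicator (fun _ => (1 : ℝ)) x ∧ B.indicator (fun _ => (1 : ℝ)) x ≤ 1 :=
    fun x => ⟨indicator_nonneg (fun _ _ => zero_le_one) _,
      indicator_le_self' (f := fun _ : ℝ => (1 : ℝ)) (fun _ _ => zero_le_one) x⟩
  -- Set and interval trade places: symmetrising `[0, y]` and integrating over `B` equals
  -- symmetrising `B` and integrating over `[0, y]`, by reflecting the variable in the second
  -- summand.
  have hI : ∀ y, 0 ≤ y → (∫ x in B, ((Icc 0 y).indicator (fun _ => (1 : ℝ)) x +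
      (Icc 0 y).indicator (fun _ => (1 : ℝ)) (1 / (β - 1) - x))) = symmMass β B y := fun y h0 => by
    unfold symmMass symmIndicator
    rw [integral_add (hy y h0).1.integrableOn (hy y h0).2.integrableOn,
      intervalIntegral.integral_add
        (intervalIntegrable_of_mem_Icc hBi (fun x => (h01 x).1) (fun x => (h01 x).2) _ _)
        (intervalIntegrable_of_mem_Icc
          (f := fun x => B.indicator (fun _ => (1 : ℝ)) (1 / (β - 1) - x)) (hBi.comp (by fun_prop))
          (fun x => (h01 _).1) (fun x => (h01 _).2) _ _),
      intervalIntegral.integral_of_le h0, intervalIntegral.integral_of_le h0,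
      ← integral_Icc_eq_integral_Ioc, ← integral_Icc_eq_integral_Ioc,
      ← integral_indicator hB, ← integral_indicator hB, ← integral_indicator measurableSet_Icc,
      ← integral_indicator measurableSet_Icc]
    congr 1
    · congr 1 with x
      by_cases hx : x ∈ B <;> by_cases hx' : x ∈ Icc 0 y <;> simp [indicator, hx, hx']
    · rw [← integral_sub_left_eq_self _ volume (1 / (β - 1))]
      congr 1 with x
      by_cases hx : 1 / (β - 1) - x ∈ B <;> by_cases hx' : x ∈ Icc 0 y <;>
        simp only [indicator, hx, hx', sub_sub_cancel] <;> simp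
  have horb : ∀ w : Fin n → Fin 2, 0 ≤ orbit β n w 1 := fun w =>
    (orbit_mem h1 h2 (one_mem_I h1 h2) n w).1
  simp only [densityTerm_eq h1 h2]
  unfold orbitTerm
  have hw : ∀ w ∈ (Finset.univ : Finset (Fin n → Fin 2)), IntegrableOn (fun x =>
      (Icc 0 (orbit β n w 1)).indicator (fun _ => (1 : ℝ)) x +
        (Icc 0 (orbit β n w 1)).indicator (fun _ => (1 : ℝ)) (1 / (β - 1) - x)) B := fun w _ =>
    ((hy _ (horb w)).1.add (hy _ (horb w)).2).integrableOn
  refine ⟨(integrable_finsetSum _ hw).const_mul _, ?_⟩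
  rw [integral_const_mul, integral_finsetSum _ hw]
  congr 1
  exact Finset.sum_congr rfl fun w _ => hI _ (horb w)

/-! ### The density and its stationarity. -/

/-- The unnormalised density. -/
noncomputable def density (β : ℝ) (x : ℝ) : ℝ := ∑' n : ℕ, densityTerm β x n

theorem density_nonneg {β : ℝ} (h1 : 1 < β) (x : ℝ) : 0 ≤ density β x :=
  tsum_nonneg fun n => densityTerm_nonneg h1 x n

theorem integral_density {β : ℝ} (h1 : 1 < β) (h2 : β < 2) {B : Set ℝ} (hB : MeasurableSet B) :
    ∫ x in B, density β x = ∑' n, orbitTerm β (symmMass β B) n := by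
  unfold density
  rw [← integral_tsum_of_summable_integral_norm fun n => (integral_densityTerm h1 h2 hB n).1]
  · exact tsum_congr fun n => (integral_densityTerm h1 h2 hB n).2
  · simp only [Real.norm_of_nonneg (densityTerm_nonneg h1 _ _),
      (integral_densityTerm h1 h2 hB _).2]
    exact summable_orbitTerm_symmMass h1 h2 B

theorem orbitTerm_zero (β : ℝ) (φ : ℝ → ℝ) : orbitTerm β φ 0 = φ 1 := by
  simp [orbitTerm, orbit]

theorem orbitTerm_nonneg {β : ℝ} (h1 : 1 < β) (h2 : β < 2) {φ : ℝ → ℝ} (h : ∀ y ∈ I β, 0 ≤ φ y)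
    (n : ℕ) : 0 ≤ orbitTerm β φ n :=
  mul_nonneg (by positivity) (Finset.sum_nonneg fun w _ =>
    h _ (orbit_mem h1 h2 (one_mem_I h1 h2) n w))

theorem symmMass_univ (β y : ℝ) : symmMass β univ y = 2 * y := by
  simp [symmMass, symmIndicator]
  ring

theorem integral_density_pos {β : ℝ} (h1 : 1 < β) (h2 : β < 2) : 0 < ∫ x, density β x := by
  rw [← setIntegral_univ, integral_density h1 h2 .univ]
  refine (summable_orbitTerm_symmMass h1 h2 univ).tsum_pos (fun n => ?_) 0 ?_
  · exact orbitTerm_nonneg h1 h2 (fun y hy => by rw [symmMass_univ]; linarith [hy.1]) n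
  · rw [orbitTerm_zero, symmMass_univ]
    norm_num

/-- A non-integrable function has Bochner integral `0`, so a positive integral is enough. -/
theorem integrable_density {β : ℝ} (h1 : 1 < β) (h2 : β < 2) : Integrable (density β) :=
  .of_integral_ne_zero (integral_density_pos h1 h2).ne'

theorem density_eq_zero {β : ℝ} (h1 : 1 < β) (h2 : β < 2) {x : ℝ} (hx : x ∉ I β) :
    density β x = 0 := by
  unfold density
  refine (tsum_congr fun n => ?_).trans tsum_zero
  unfold densityTerm
  rw [Finset.sum_eq_zero fun w _ => ?_, mul_zero]
  have hM := one_mem_I h1 h2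
  rw [indicator_of_notMem fun h =>
      hx ⟨h.1, h.2.trans (orbit_mem h1 h2 hM n w).2⟩,
    indicator_of_notMem fun h => hx ⟨(orbit_mem h1 h2 ?_ n w).1.trans h.1, h.2⟩, add_zero]
  constructor <;> linarith [hM.1, hM.2]

/-- Reflection exchanges the two fibre maps, so preimage and symmetrisation commute after summing
over both letters. -/
theorem sum_symmIndicator_preimage {β : ℝ} (h1 : 1 < β) (h2 : β < 2) (B : Set ℝ) {x : ℝ}
    (hx : x ∈ I β) :
    ∑ i : Fin 2, symmIndicator β (fiberMap β i ⁻¹' B) x =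
      ∑ i : Fin 2, symmIndicator β B (fiberMap β i x) := by
  unfold symmIndicator
  rw [Finset.sum_add_distrib, Finset.sum_add_distrib]
  congr 1
  rw [← Equiv.sum_comp Fin.revPerm]
  refine Finset.sum_congr rfl fun i _ => ?_
  have e : 1 / (β - 1) - x ∈ fiberMap β (Fin.revPerm i) ⁻¹' B ↔
      1 / (β - 1) - fiberMap β i x ∈ B := by
    rw [mem_preimage, fiberMap_reflect h1 h2 _ hx, Fin.revPerm_apply, Fin.rev_rev]
  by_cases h : 1 / (β - 1) - fiberMap β i x ∈ B
  · rw [indicator_of_mem h, indicator_of_mem (e.mpr h)]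
  · rw [indicator_of_notMem h, indicator_of_notMem (mt e.mp h)]

theorem sum_symmMass_preimage {β : ℝ} (h1 : 1 < β) (h2 : β < 2) {B : Set ℝ} (hB : MeasurableSet B)
    {y : ℝ} (hy : y ∈ I β) :
    ∑ i : Fin 2, symmMass β (fiberMap β i ⁻¹' B) y =
      β⁻¹ * (∑ i : Fin 2, symmMass β B (fiberMap β i y) + escape β y * symmMass β B 1) := by
  have hint : ∀ {C : Set ℝ}, MeasurableSet C → ∀ a b,
      IntervalIntegrable (symmIndicator β C) volume a b := fun hC =>
    intervalIntegrable_of_mem_Icc (measurable_symmIndicator β hC) (symmIndicator_nonneg β _)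
      (symmIndicator_le β _)
  have hint' : ∀ i a b, IntervalIntegrable (fun x => symmIndicator β B (fiberMap β i x))
      volume a b := fun i =>
    intervalIntegrable_of_mem_Icc ((measurable_symmIndicator β hB).comp (measurable_fiberMap β i))
      (fun x => symmIndicator_nonneg β _ _) (fun x => symmIndicator_le β _ _)
  unfold symmMass
  rw [← sum_integral_fiberMap h1 h2 (hint hB) hint' (symmIndicator_reflect β B) hy,
    ← intervalIntegral.integral_finsetSum fun i _ => hint (measurable_fiberMap β i hB) _ _,
    ← intervalIntegral.integral_finsetSum fun i _ => hint' i _ _]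
  exact intervalIntegral.integral_congr_Ioo_of_le hy.1 fun x hx =>
    sum_symmIndicator_preimage h1 h2 B ⟨hx.1.le, hx.2.le.trans hy.2⟩

/-- The measure with the unnormalised density is stationary up to a multiple of its first term. -/
theorem sum_tsum_orbitTerm_preimage {β : ℝ} (h1 : 1 < β) (h2 : β < 2) {B : Set ℝ}
    (hB : MeasurableSet B) :
    ∑ i : Fin 2, ∑' n, orbitTerm β (symmMass β (fiberMap β i ⁻¹' B)) n =
      2 * ∑' n, orbitTerm β (symmMass β B) n +
        (∑' n, orbitTerm β (fun y => β⁻¹ * escape β y) n - 2) * symmMass β B 1 := by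
  have hβ : 0 < β := by linarith
  have hes : Summable (orbitTerm β fun y => β⁻¹ * escape β y) := by
    refine summable_orbitTerm h1 h2 (k := β⁻¹ * 2) fun y _ => ?_
    rw [abs_of_nonneg (mul_nonneg (inv_nonneg.mpr hβ.le) (escape_nonneg β y))]
    exact mul_le_mul_of_nonneg_left (escape_le_two β y) (inv_nonneg.mpr hβ.le)
  have hS := summable_orbitTerm_symmMass h1 h2 B
  have hstep : ∀ n, ∑ i : Fin 2, orbitTerm β (symmMass β (fiberMap β i ⁻¹' B)) n =
      2 * orbitTerm β (symmMass β B) (n + 1) +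
        orbitTerm β (fun y => β⁻¹ * escape β y) n * symmMass β B 1 := fun n => by
    rw [Fin.sum_univ_two, ← orbitTerm_add, orbitTerm_succ, ← orbitTerm_mul_const, mul_comm 2,
      ← orbitTerm_mul_const, ← orbitTerm_add]
    refine orbitTerm_congr h1 h2 (fun y hy => ?_) n
    have := sum_symmMass_preimage h1 h2 hB hy
    rw [Fin.sum_univ_two] at this
    rw [this]
    field_simp
  rw [← Summable.tsum_finsetSum fun i _ => summable_orbitTerm_symmMass h1 h2 _, tsum_congr hstep,
    Summable.tsum_add (((summable_nat_add_iff 1).mpr hS).mul_left 2) (hes.mul_right _),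
    tsum_mul_left, tsum_mul_right, hS.tsum_eq_zero_add, orbitTerm_zero]
  ring

theorem sum_integral_density_preimage {β : ℝ} (h1 : 1 < β) (h2 : β < 2) {B : Set ℝ}
    (hB : MeasurableSet B) :
    ∑ i : Fin 2, ∫ x in fiberMap β i ⁻¹' B, density β x = 2 * ∫ x in B, density β x := by
  -- The constant is never computed: for `B = univ` both preimages are `univ`, so the error term
  -- must vanish, while `symmMass β univ 1 = 2` is not zero.
  have hc : ∑' n, orbitTerm β (fun y => β⁻¹ * escape β y) n - 2 = 0 := by
    have := sum_tsum_orbitTerm_preimage h1 h2 MeasurableSet.univ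
    simp only [preimage_univ, Fin.sum_univ_two, symmMass_univ β 1] at this
    linarith
  simp only [integral_density h1 h2 hB, integral_density h1 h2 (measurable_fiberMap β _ hB)]
  rw [sum_tsum_orbitTerm_preimage h1 h2 hB, hc, zero_mul, add_zero]

/-! ### Forward invariant sets fill the switch region. -/

section ForwardInvariant

variable {β : ℝ} {A : Set ℝ}

/-- Apart from a null set, a point whose image misses `A` lies outside `A` itself. As lengths also
grow by `β`, the proportion of the interval missed by `A` does not increase. -/
theorem volume_image_diff_le (h1 : 1 < β) {i : Fin 2}
    (hA : volume (A \ fiberMap β i ⁻¹' A) = 0) {a b c : ℝ}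
    (hc : ∀ x ∈ Icc a b, fiberMap β i x = β * x - c) :
    volume (Icc (β * a - c) (β * b - c) \ A) ≤ ENNReal.ofReal β * volume (Icc a b \ A) := by
  have hβ : 0 < β := by linarith
  set E := Icc (β * a - c) (β * b - c) \ A
  have hpre : volume ((β * ·) ⁻¹' ((· - c) ⁻¹' E)) = ENNReal.ofReal β⁻¹ * volume E := by
    rw [Real.volume_preimage_mul_left hβ.ne', abs_of_pos (inv_pos.mpr hβ),
      (measurePreserving_sub_right volume c).measure_preimage_emb
        (MeasurableEquiv.subRight c).measurableEmbedding]
  have hsub : (β * ·) ⁻¹' ((· - c) ⁻¹' E) ⊆ (Icc a b \ A) ∪ (A \ fiberMap β i ⁻¹' A) := by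
    rintro x ⟨⟨hxa, hxb⟩, hxA⟩
    have hx : x ∈ Icc a b :=
      ⟨le_of_mul_le_mul_left (by linarith) hβ, le_of_mul_le_mul_left (by linarith) hβ⟩
    by_cases h : x ∈ A
    · exact .inr ⟨h, fun h' => hxA (by rwa [mem_preimage, hc x hx] at h')⟩
    · exact .inl ⟨hx, h⟩
  have hle : ENNReal.ofReal β⁻¹ * volume E ≤ volume (Icc a b \ A) := by
    rw [← hpre]
    refine (measure_mono hsub).trans ((measure_union_le _ _).trans ?_)
    rw [hA, add_zero]
  calc volume E = ENNReal.ofReal β * (ENNReal.ofReal β⁻¹ * volume E) := by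
        rw [← mul_assoc, ← ENNReal.ofReal_mul hβ.le, mul_inv_cancel₀ hβ.ne', ENNReal.ofReal_one,
          one_mul]
    _ ≤ _ := mul_le_mul_right hle _

/-- An interval that is mostly filled by a forward invariant set can be expanded, always by a
suitable branch that is affine on it, until it contains the switch region. -/
theorem volume_switch_diff_le (h1 : 1 < β) (h2 : β < 2)
    (hA : ∀ i, volume (A \ fiberMap β i ⁻¹' A) = 0) (ε : ENNReal) (n : ℕ) :
    ∀ a b : ℝ, 0 ≤ a → a ≤ b → b ≤ 1 / (β - 1) → 1 / (β - 1) < β ^ n * (b - a) →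
      volume (Icc a b \ A) ≤ ε * ENNReal.ofReal (b - a) →
      volume (S β \ A) ≤ ε * ENNReal.ofReal (1 / (β - 1)) := by
  have hβ : 0 < β := by linarith
  have hb : β - 1 ≠ 0 := by linarith
  obtain ⟨hs, hst, htM, hM, hM1⟩ := switch_bounds h1 h2
  have hq : β * (1 / β) = 1 := by field_simp
  have hq' : β * (1 / (β * (β - 1))) = 1 / (β - 1) := by field_simp
  have hβM : β * (1 / (β - 1)) = 1 / (β - 1) + 1 := by field_simp; ring
  induction n with
  | zero => intro a b ha hab hbM hn; linarith [pow_zero β]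
  | succ n ih =>
    intro a b ha hab hbM hn hvol
    have key : ∀ (i : Fin 2) (c : ℝ), (∀ x ∈ Icc a b, fiberMap β i x = β * x - c) →
        0 ≤ β * a - c → β * b - c ≤ 1 / (β - 1) →
        volume (S β \ A) ≤ ε * ENNReal.ofReal (1 / (β - 1)) := fun i c hc h0 hM' => by
      have hlen : β * b - c - (β * a - c) = β * (b - a) := by ring
      refine ih (β * a - c) (β * b - c) h0 (by nlinarith) hM' ?_ ?_
      · rw [hlen, ← mul_assoc, ← pow_succ]
        exact hn
      · refine (volume_image_diff_le h1 (hA i) hc).trans ?_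
        rw [hlen, ENNReal.ofReal_mul hβ.le, mul_left_comm]
        exact mul_le_mul_right hvol _
    -- Letter `0` is affine up to the right end of the switch region and letter `1` from its left
    -- end on. An interval fitting neither contains the whole switch region.
    rcases le_or_gt b (1 / (β * (β - 1))) with hbt | hbt
    · refine key 0 0 (fun x hx => ?_) (by rw [sub_zero]; positivity) ?_
      · rw [fiberMap_zero_of_le (ha.trans hx.1) (hx.2.trans hbt), sub_zero]
      · nlinarith
    rcases le_or_gt (1 / β) a with has | has
    · exact key 1 1 (fun x hx => fiberMap_one_of_le (has.trans hx.1)) (by nlinarith) (by nlinarith)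
    · refine (measure_mono (sdiff_subset_sdiff_left (Icc_subset_Icc has.le hbt.le))).trans
        (hvol.trans ?_)
      gcongr
      linarith

/-- A forward invariant set of positive measure contains almost all of the switch region. -/
theorem volume_switch_diff_eq_zero (h1 : 1 < β) (h2 : β < 2) (hAm : MeasurableSet A)
    (hA : ∀ i, volume (A \ fiberMap β i ⁻¹' A) = 0) (hAI : volume (A \ I β) = 0)
    (hpos : volume A ≠ 0) : volume (S β \ A) = 0 := by
  have hM : 0 < 1 / (β - 1) := by linarith [(switch_bounds h1 h2).2.2.2.2]
  have hpos' : volume (A ∩ Ioo 0 (1 / (β - 1))) ≠ 0 := fun h => hpos <| by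
    have hsub : A ⊆ (A ∩ Ioo 0 (1 / (β - 1))) ∪ ((A \ I β) ∪ {0, 1 / (β - 1)}) := fun x hx => by
      by_cases hxI : x ∈ I β
      · rcases hxI.1.eq_or_lt with h0 | h0
        · exact .inr (.inr (.inl h0.symm))
        rcases hxI.2.eq_or_lt with h0' | h0'
        · exact .inr (.inr (.inr h0'))
        exact .inl ⟨hx, h0, h0'⟩
      · exact .inr (.inl ⟨hx, hxI⟩)
    exact measure_mono_null hsub (measure_union_null h (measure_union_null hAI
      ((Set.toFinite _).measure_zero volume)))
  obtain ⟨x, ⟨hxA, hx0, hxM⟩, hlim⟩ : ∃ x ∈ A ∩ Ioo 0 (1 / (β - 1)), Filter.Tendsto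
      (fun r => volume (Aᶜ ∩ Metric.closedBall x r) / volume (Metric.closedBall x r))
      (nhdsWithin 0 (Ioi 0)) (nhds (Aᶜ.indicator 1 x)) := by
    by_contra! hcon
    exact hpos' (measure_mono_null (fun x hx => hcon x hx)
      (Besicovitch.ae_tendsto_measure_inter_div_of_measurableSet volume hAm.compl))
  rw [indicator_of_notMem (show x ∉ Aᶜ from fun h => h hxA)] at hlim
  have hε : ∀ ε : ENNReal, 0 < ε → volume (S β \ A) ≤ ε * ENNReal.ofReal (1 / (β - 1)) := by
    intro ε hε
    have hsmall : ∀ᶠ r : ℝ in nhdsWithin 0 (Ioi 0), r < min x (1 / (β - 1) - x) :=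
      nhdsWithin_le_nhds (Iio_mem_nhds (lt_min hx0 (by linarith)))
    obtain ⟨r, hr, hrm, hr0⟩ := ((hlim.eventually_lt_const hε).and
      (hsmall.and self_mem_nhdsWithin)).exists
    have hr0 : 0 < r := hr0
    obtain ⟨hrx, hrM⟩ := lt_min_iff.mp hrm
    obtain ⟨n, hn⟩ := pow_unbounded_of_one_lt (1 / (β - 1) / (2 * r)) h1
    have hlen : x + r - (x - r) = 2 * r := by ring
    refine volume_switch_diff_le h1 h2 hA ε n (x - r) (x + r) (by linarith) (by linarith)
      (by linarith) ?_ ?_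
    · rw [hlen, ← div_lt_iff₀ (by positivity)]
      exact hn
    · have hball : volume (Metric.closedBall x r) = ENNReal.ofReal (2 * r) :=
        Real.volume_closedBall x r
      rw [hball, Real.closedBall_eq_Icc] at hr
      rw [hlen, sdiff_eq, inter_comm]
      exact (ENNReal.div_le_iff_le_mul (.inl (by simpa using hr0)) (.inl ENNReal.ofReal_ne_top)).mp
        hr.le
  by_contra hne
  have hM' : ENNReal.ofReal (1 / (β - 1)) ≠ 0 := by simpa using hM
  have hfin : volume (S β \ A) ≠ ⊤ :=
    ne_top_of_le_ne_top (by simp [S]) (measure_mono (sdiff_subset (s := S β) (t := A)))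
  -- This `ε` makes the bound half of the volume being bounded.
  have h := hε (volume (S β \ A) / 2 / ENNReal.ofReal (1 / (β - 1)))
    (ENNReal.div_pos (ENNReal.half_pos hne).ne' ENNReal.ofReal_ne_top)
  rw [ENNReal.div_mul_cancel hM' ENNReal.ofReal_ne_top] at h
  exact absurd (ENNReal.half_lt_self hne hfin) (not_lt.mpr h)

end ForwardInvariant

/-! ### Uniqueness of the stationary measure. -/

section Uniqueness

theorem measure_eq_zero_of_setIntegral_nonpos {α : Type*} [MeasurableSpace α] {μ : Measure α}
    {h : α → ℝ} (hi : Integrable h μ) {E : Set α} (hE : MeasurableSet E) (hpos : ∀ x ∈ E, 0 < h x)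
    (hint : ∫ x in E, h x ∂μ ≤ 0) : μ E = 0 := by
  by_contra hne
  have := (setIntegral_pos_iff_support_of_nonneg_ae
    ((ae_restrict_iff' hE).mpr (.of_forall fun x hx => (hpos x hx).le)) hi.integrableOn).mpr
    (by rw [inter_eq_right.mpr fun x hx => Function.mem_support.mpr (hpos x hx).ne']
        exact pos_iff_ne_zero.mpr hne)
  linarith

/-- The positivity set of a stationary signed density is forward invariant. -/
theorem forward_invariant_of_stationary {β : ℝ} {h : ℝ → ℝ} (hm : Measurable h)
    (hi : Integrable h) (hstat : ∀ B, MeasurableSet B →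
      ∑ i : Fin 2, ∫ x in fiberMap β i ⁻¹' B, h x = 2 * ∫ x in B, h x) (i : Fin 2) :
    volume ({x | 0 < h x} \ fiberMap β i ⁻¹' {x | 0 < h x}) = 0 := by
  set A := {x | 0 < h x}
  have hAm : MeasurableSet A := measurableSet_lt measurable_const hm
  -- `A` maximises the integral of `h`. Stationarity makes the two preimages of `A` attain twice
  -- that maximum in total, so neither can lose any of `A`.
  have hle : ∀ E, MeasurableSet E → ∫ x in E, h x ≤ (∫ x in A, h x) - ∫ x in A \ E, h x := by
    intro E hE
    have h1 := integral_inter_add_sdiff (s := A) (t := E) hE hi.integrableOn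
    have h2 := integral_inter_add_sdiff (s := E) (t := A) hAm hi.integrableOn
    have h3 := setIntegral_nonpos (μ := volume) (hE.diff hAm) fun x hx => not_lt.mp hx.2
    rw [inter_comm] at h2
    linarith
  have hnn : ∀ j, 0 ≤ ∫ x in A \ fiberMap β j ⁻¹' A, h x := fun j =>
    setIntegral_nonneg (hAm.diff (measurable_fiberMap β j hAm)) fun x hx => (le_of_lt hx.1)
  have hst := hstat A hAm
  have hsum := Finset.sum_le_sum fun j (_ : j ∈ Finset.univ) =>
    hle _ (measurable_fiberMap β j hAm)
  refine measure_eq_zero_of_setIntegral_nonpos hi (hAm.diff (measurable_fiberMap β i hAm))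
    (fun x hx => hx.1) ?_
  have hsingle := Finset.single_le_sum (fun j _ => hnn j) (Finset.mem_univ i)
  rw [Finset.sum_sub_distrib, hst] at hsum
  simp only [Finset.sum_const, Finset.card_univ, Fintype.card_fin, nsmul_eq_mul] at hsum
  push_cast at hsum
  linarith

/-- Invariance of a measure on the line under the average of the two fibre maps. -/
def IsStationary (β : ℝ) (μ : Measure ℝ) : Prop :=
  ∀ B, MeasurableSet B → ∑ i : Fin 2, μ (fiberMap β i ⁻¹' B) = 2 * μ B

theorem stationary_unique {β : ℝ} (h1 : 1 < β) (h2 : β < 2) {μ ν : Measure ℝ}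
    [IsProbabilityMeasure μ] [IsProbabilityMeasure ν] (hμ : μ ≪ volume) (hν : ν ≪ volume)
    (hμI : μ (I β)ᶜ = 0) (hνI : ν (I β)ᶜ = 0) (hμs : IsStationary β μ) (hνs : IsStationary β ν) :
    μ = ν := by
  set h : ℝ → ℝ := fun x => (μ.rnDeriv volume x).toReal - (ν.rnDeriv volume x).toReal with hh
  have hm : Measurable h :=
    (Measure.measurable_rnDeriv μ volume).ennreal_toReal.sub
      (Measure.measurable_rnDeriv ν volume).ennreal_toReal
  have hi : Integrable h :=
    Measure.integrable_toReal_rnDeriv.sub Measure.integrable_toReal_rnDeriv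
  have hset : ∀ B : Set ℝ, ∫ x in B, h x = μ.real B - ν.real B := fun B => by
    rw [hh, integral_sub Measure.integrable_toReal_rnDeriv.integrableOn
      Measure.integrable_toReal_rnDeriv.integrableOn, Measure.setIntegral_toReal_rnDeriv hμ,
      Measure.setIntegral_toReal_rnDeriv hν]
  have hreal : ∀ (ρ : Measure ℝ) [IsProbabilityMeasure ρ], IsStationary β ρ → ∀ B,
      MeasurableSet B → ∑ i : Fin 2, ρ.real (fiberMap β i ⁻¹' B) = 2 * ρ.real B := by
    intro ρ _ hρ B hB
    have := congrArg ENNReal.toReal (hρ B hB)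
    rw [ENNReal.toReal_sum fun i _ => measure_ne_top _ _, ENNReal.toReal_mul] at this
    simpa [Measure.real] using this
  have hstat : ∀ B, MeasurableSet B →
      ∑ i : Fin 2, ∫ x in fiberMap β i ⁻¹' B, h x = 2 * ∫ x in B, h x := fun B hB => by
    simp only [hset]
    rw [Finset.sum_sub_distrib, hreal μ hμs B hB, hreal ν hνs B hB, mul_sub]
  have hIz : ∀ E : Set ℝ, ∫ x in E \ I β, h x = 0 := fun E => by
    have hsub : E \ I β ⊆ (I β)ᶜ := fun x hx => hx.2
    rw [hset, measureReal_def, measureReal_def, measure_mono_null hsub hμI,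
      measure_mono_null hsub hνI, sub_self]
  have htot : ∫ x, h x = 0 := by
    rw [← setIntegral_univ, hset]; simp
  suffices hzero : h =ᵐ[volume] 0 by
    refine Measure.ext fun B _ => ?_
    have := hset B
    rw [integral_congr_ae (ae_restrict_of_ae hzero)] at this
    simp only [Pi.zero_apply, integral_zero] at this
    exact (measureReal_eq_measureReal_iff).mp (by linarith)
  by_cases hp : volume {x | 0 < h x} = 0
  · have hle : 0 ≤ᵐ[volume] fun x => -h x := by
      filter_upwards [measure_eq_zero_iff_ae_notMem.mp hp] with x hx
      simpa using hx
    filter_upwards [(integral_eq_zero_iff_of_nonneg_ae hle hi.neg).mp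
      (by rw [integral_neg, htot, neg_zero])] with x hx
    simpa using hx
  by_cases hn : volume {x | 0 < -h x} = 0
  · have hle : 0 ≤ᵐ[volume] h := by
      filter_upwards [measure_eq_zero_iff_ae_notMem.mp hn] with x hx
      simpa using hx
    exact (integral_eq_zero_iff_of_nonneg_ae hle hi).mp htot
  exfalso
  have hpm : MeasurableSet {x | 0 < h x} := measurableSet_lt measurable_const hm
  have hnm : MeasurableSet {x | 0 < -h x} := measurableSet_lt measurable_const hm.neg
  have hIm : MeasurableSet (I β) := measurableSet_Icc
  have hSp := volume_switch_diff_eq_zero h1 h2 hpm (forward_invariant_of_stationary hm hi hstat)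
    (measure_eq_zero_of_setIntegral_nonpos hi (hpm.diff hIm) (fun x hx => hx.1) (hIz _).le) hp
  have hSn := volume_switch_diff_eq_zero h1 h2 hnm
    (forward_invariant_of_stationary hm.neg hi.neg fun B hB => by
      simp only [integral_neg, Finset.sum_neg_distrib, hstat B hB, mul_neg])
    (measure_eq_zero_of_setIntegral_nonpos hi.neg (hnm.diff hIm) (fun x hx => hx.1)
      (by simp only [Pi.neg_apply, integral_neg, hIz]; simp)) hn
  have hS : volume (S β) = 0 := by
    refine measure_mono_null (fun x hx => ?_) (measure_union_null hSp hSn)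
    by_cases hxp : 0 < h x
    · exact .inr ⟨hx, fun hxn => by have : 0 < -h x := hxn; linarith⟩
    · exact .inl ⟨hx, hxp⟩
  have hst := (switch_bounds h1 h2).2.1
  rw [S, Real.volume_Icc, ENNReal.ofReal_eq_zero] at hS
  linarith

end Uniqueness

/-! ### Reduction of invariance under `K` to stationarity on the line. -/

instance : IsProbabilityMeasure bernoulli := by
  unfold bernoulli
  infer_instance

theorem measurable_shift : Measurable shift :=
  measurable_pi_lambda _ fun n => measurable_pi_apply (n + 1)

/-- Under the Bernoulli measure the first letter is uniform and independent of the shift. -/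
theorem bernoulli_first_inter_shift (i : Fin 2) {A : Set Omega} (hA : MeasurableSet A) :
    bernoulli {ω | ω 0 = i ∧ shift ω ∈ A} = 2⁻¹ * bernoulli A := by
  have hfirst : MeasurableSet {ω : Omega | ω 0 = i} :=
    measurableSet_eq_fun (measurable_pi_apply 0) measurable_const
  have hmap : ∀ B, MeasurableSet B →
      ((2 : ENNReal) • (bernoulli.restrict {ω | ω 0 = i}).map shift) B =
        2 * bernoulli {ω | ω 0 = i ∧ shift ω ∈ B} := fun B hB => by
    rw [Measure.smul_apply, smul_eq_mul, Measure.map_apply measurable_shift hB,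
      Measure.restrict_apply (measurable_shift hB), inter_comm]
    rfl
  have heq : (2 : ENNReal) • (bernoulli.restrict {ω | ω 0 = i}).map shift = bernoulli := by
    conv_rhs => unfold bernoulli
    refine Measure.eq_infinitePi _ fun s t ht => ?_
    rw [hmap _ (.pi s.countable_toSet fun k _ => ht k)]
    -- The cylinder with `{i}` prepended; its extra coordinate contributes the factor `2⁻¹`.
    let t' : ℕ → Set (Fin 2) := fun k => k.casesOn {i} t
    have hset : {ω : Omega | ω 0 = i ∧ shift ω ∈ Set.pi s t} =
        Set.pi ((insert 0 (s.map (addRightEmbedding 1)) : Finset ℕ) : Set ℕ) t' := by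
      ext ω
      simp [Set.mem_pi, t', shift]
    have ht' : ∀ k, MeasurableSet (t' k) := fun k => .of_discrete
    rw [hset, bernoulli, Measure.infinitePi_pi _ fun k _ => ht' k, Finset.prod_insert (by simp),
      Finset.prod_map]
    have hi : (PMF.uniformOfFintype (Fin 2)).toMeasure (t' 0) = 2⁻¹ := by
      change (PMF.uniformOfFintype (Fin 2)).toMeasure {i} = 2⁻¹
      rw [PMF.toMeasure_apply_singleton _ _ (measurableSet_singleton i)]
      simp
    rw [hi, ← mul_assoc, ENNReal.mul_inv_cancel two_ne_zero ENNReal.ofNat_ne_top, one_mul]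
    rfl
  conv_rhs => rw [← heq]
  rw [hmap A hA, ← mul_assoc, ENNReal.inv_mul_cancel two_ne_zero ENNReal.ofNat_ne_top, one_mul]

theorem measurable_K (β : ℝ) : Measurable (K β) := by
  have hT : ∀ f : Omega × ℝ → Fin 2, Measurable f →
      Measurable fun p : Omega × ℝ => T β (f p) p.2 := fun f hf => by
    unfold T
    exact (measurable_snd.const_mul β).sub ((measurable_of_countable fun j : Fin 2 =>
      ((j : ℕ) : ℝ)).comp hf)
  unfold K
  refine Measurable.ite (measurable_snd measurableSet_Ico) ?_
    (Measurable.ite (measurable_snd measurableSet_Icc) ?_ ?_)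
  · exact measurable_fst.prodMk (hT _ measurable_const)
  · exact (measurable_shift.comp measurable_fst).prodMk
      (hT _ ((measurable_pi_apply 0).comp measurable_fst))
  · exact measurable_fst.prodMk (hT _ measurable_const)

open Classical in
-- Whether or not `K` shifts, the new sequence is Bernoulli and independent of the letter used. Off
-- the switch region the two summands coincide, so their average is harmless.
theorem bernoulli_section_K (β : ℝ) {A : Set Omega} (hA : MeasurableSet A) (B : Set ℝ) (x : ℝ) :
    bernoulli {ω | K β (ω, x) ∈ A ×ˢ B} =
      2⁻¹ * bernoulli A * ∑ i : Fin 2, (fiberMap β i ⁻¹' B).indicator 1 x := by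
  have hfix : ∀ y : ℝ, bernoulli {ω | (ω, y) ∈ A ×ˢ B} =
      2⁻¹ * bernoulli A * ∑ _i : Fin 2, B.indicator 1 y := fun y => by
    by_cases hy : y ∈ B
    · simp only [mem_prod, hy, and_true, ofPred_mem_eq, indicator_of_mem hy, Pi.one_apply,
        Finset.sum_const, Finset.card_univ, Fintype.card_fin, nsmul_eq_mul, mul_one]
      rw [mul_right_comm, Nat.cast_ofNat, ENNReal.inv_mul_cancel two_ne_zero ENNReal.ofNat_ne_top,
        one_mul]
    · simp [hy]
  have hpre : ∀ i, (fiberMap β i ⁻¹' B).indicator (1 : ℝ → ENNReal) x =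
      B.indicator 1 (fiberMap β i x) := fun i => rfl
  simp only [hpre]
  unfold K fiberMap
  dsimp only
  split_ifs with hL hS
  · exact hfix _
  · have hsplit : {ω : Omega | (shift ω, T β (ω 0) x) ∈ A ×ˢ B} =
        ⋃ i : Fin 2, {ω | ω 0 = i ∧ shift ω ∈ A ∧ T β i x ∈ B} := by
      ext ω
      simp
    have hm : ∀ i : Fin 2, {ω : Omega | ω 0 = i ∧ shift ω ∈ A ∧ T β i x ∈ B} =
        if T β i x ∈ B then {ω | ω 0 = i ∧ shift ω ∈ A} else ∅ := fun i => by
      split_ifs with h <;> simp [h]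
    have hme : ∀ i : Fin 2, MeasurableSet {ω : Omega | ω 0 = i ∧ shift ω ∈ A} := fun i =>
      (measurableSet_eq_fun (measurable_pi_apply 0) measurable_const).inter (measurable_shift hA)
    rw [hsplit, measure_iUnion, tsum_fintype, Finset.mul_sum]
    · refine Finset.sum_congr rfl fun i _ => ?_
      rw [hm]
      by_cases h : T β i x ∈ B
      · rw [if_pos h, bernoulli_first_inter_shift i hA, indicator_of_mem h, Pi.one_apply, mul_one]
      · rw [if_neg h, indicator_of_notMem h, measure_empty, mul_zero]
    · exact fun i j hij => disjoint_left.mpr fun ω hω hω' => hij (hω.1.symm.trans hω'.1)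
    · intro i
      rw [hm]
      split_ifs
      exacts [hme i, .empty]
  · exact hfix _

theorem prod_preimage_K (β : ℝ) (μ : Measure ℝ) [SFinite μ] {A : Set Omega}
    (hA : MeasurableSet A) {B : Set ℝ} (hB : MeasurableSet B) :
    (bernoulli.prod μ) (K β ⁻¹' A ×ˢ B) =
      2⁻¹ * bernoulli A * ∑ i : Fin 2, μ (fiberMap β i ⁻¹' B) := by
  have hm := fun i => measurable_fiberMap β i hB
  rw [Measure.prod_apply_symm (measurable_K β (hA.prod hB))]
  refine (lintegral_congr fun x => bernoulli_section_K β hA B x).trans ?_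
  rw [lintegral_const_mul _ (Finset.measurable_fun_sum _ fun i _ =>
      measurable_one.indicator (hm i)),
    lintegral_finsetSum _ fun i _ => measurable_one.indicator (hm i)]
  congr 1
  exact Finset.sum_congr rfl fun i _ => lintegral_indicator_one (hm i)

theorem measurePreserving_K_iff (β : ℝ) (μ : Measure ℝ) [IsProbabilityMeasure μ] :
    MeasurePreserving (K β) (bernoulli.prod μ) (bernoulli.prod μ) ↔ IsStationary β μ := by
  have h2 : (2 : ENNReal) * 2⁻¹ = 1 := ENNReal.mul_inv_cancel two_ne_zero ENNReal.ofNat_ne_top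
  constructor
  · intro h B hB
    have := h.measure_preimage (MeasurableSet.univ.prod hB).nullMeasurableSet
    rw [prod_preimage_K β μ .univ hB, Measure.prod_prod, measure_univ, one_mul, mul_one] at this
    rw [← this, ← mul_assoc, h2, one_mul]
  · intro h
    refine ⟨measurable_K β, (Measure.prod_eq fun A B hA hB => ?_).symm⟩
    rw [Measure.map_apply (measurable_K β) (hA.prod hB), prod_preimage_K β μ hA hB, h B hB,
      mul_comm 2⁻¹, mul_assoc, ← mul_assoc 2⁻¹, mul_comm 2⁻¹, h2, one_mul]

/-! ### The normalised measure and the conclusion. -/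

theorem withDensity_density_apply {β : ℝ} (h1 : 1 < β) (h2 : β < 2) {C : ℝ} (hC : 0 ≤ C)
    {B : Set ℝ} (hB : MeasurableSet B) :
    volume.withDensity (fun x => ENNReal.ofReal (C * density β x)) B =
      ENNReal.ofReal (C * ∫ x in B, density β x) := by
  rw [withDensity_apply _ hB, ← integral_const_mul, ofReal_integral_eq_lintegral_ofReal
    ((integrable_density h1 h2).integrableOn.const_mul C)
    (.of_forall fun x => mul_nonneg hC (density_nonneg h1 x))]

theorem setIntegral_I_density {β : ℝ} (h1 : 1 < β) (h2 : β < 2) :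
    ∫ x in I β, density β x = ∫ x, density β x :=
  setIntegral_eq_integral_of_forall_compl_eq_zero fun _ hx => density_eq_zero h1 h2 hx

theorem isUnbiasedACIM_withDensity {β : ℝ} (h1 : 1 < β) (h2 : β < 2) {C : ℝ} (hC : 0 ≤ C)
    (hint : C * ∫ x, density β x = 1) :
    IsUnbiasedACIM β (volume.withDensity fun x => ENNReal.ofReal (C * density β x)) := by
  have hprob : IsProbabilityMeasure
      (volume.withDensity fun x => ENNReal.ofReal (C * density β x)) := ⟨by
    rw [withDensity_density_apply h1 h2 hC .univ, setIntegral_univ, hint, ENNReal.ofReal_one]⟩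
  refine ⟨hprob, ?_, withDensity_absolutelyContinuous _ _, (measurePreserving_K_iff β _).mpr ?_⟩
  · rw [withDensity_density_apply h1 h2 hC
      (show MeasurableSet (I β)ᶜ from measurableSet_Icc.compl),
      setIntegral_eq_zero_of_forall_eq_zero (t := (I β)ᶜ)
        fun x hx => density_eq_zero h1 h2 hx]
    simp
  · intro B hB
    have hnn : ∀ i : Fin 2, 0 ≤ C * ∫ x in fiberMap β i ⁻¹' B, density β x := fun i =>
      mul_nonneg hC (integral_nonneg fun x => density_nonneg h1 x)
    simp only [withDensity_density_apply h1 h2 hC hB,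
      withDensity_density_apply h1 h2 hC (measurable_fiberMap β _ hB)]
    rw [← ENNReal.ofReal_sum_of_nonneg fun i _ => hnn i, ← Finset.mul_sum,
      sum_integral_density_preimage h1 h2 hB, ← ENNReal.ofReal_ofNat 2,
      ← ENNReal.ofReal_mul zero_le_two, mul_left_comm]

end RandomBeta

theorem theorem1 (β : ℝ) (hβ : β ∈ Set.Ioo (1 : ℝ) 2) :
    (∀ x : ℝ, Summable (RandomBeta.densityTerm β x)) ∧
    ∃ C : ℝ, 0 < C ∧
      (∫ x in RandomBeta.I β, C * ∑' n : ℕ, RandomBeta.densityTerm β x n) = 1 ∧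
      ∀ μ : MeasureTheory.Measure ℝ,
        RandomBeta.IsUnbiasedACIM β μ ↔
          μ = MeasureTheory.volume.withDensity
            (fun x => ENNReal.ofReal (C * ∑' n : ℕ, RandomBeta.densityTerm β x n)) := by
  obtain ⟨h1, h2⟩ := hβ
  have hpos := RandomBeta.integral_density_pos h1 h2
  have hC : (∫ x, RandomBeta.density β x)⁻¹ * ∫ x, RandomBeta.density β x = 1 :=
    inv_mul_cancel₀ hpos.ne'
  refine ⟨RandomBeta.summable_densityTerm h1 h2, (∫ x, RandomBeta.density β x)⁻¹,
    inv_pos.mpr hpos, ?_, fun μ => ?_⟩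
  · change ∫ x in RandomBeta.I β, _ * RandomBeta.density β x = 1
    rw [integral_const_mul, RandomBeta.setIntegral_I_density h1 h2, hC]
  · have hν := RandomBeta.isUnbiasedACIM_withDensity h1 h2 (inv_pos.mpr hpos).le hC
    constructor
    · intro hμ
      have := hμ.isProbabilityMeasure
      have := hν.isProbabilityMeasure
      change μ = MeasureTheory.volume.withDensity fun x =>
        ENNReal.ofReal ((∫ x, RandomBeta.density β x)⁻¹ * RandomBeta.density β x)
      exact RandomBeta.stationary_unique h1 h2 hμ.absolutelyContinuous hν.absolutelyContinuous
        hμ.support hν.support ((RandomBeta.measurePreserving_K_iff β μ).mp hμ.invariant)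
        ((RandomBeta.measurePreserving_K_iff β _).mp hν.invariant)
    · rintro rfl
      exact hν
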